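/- Call a jointly monic span $f\colon A\leftarrow R\rightarrow B\colon g$ in a category with finite limits a *Mal'cev span* if $(f\pi_1,g\pi_3)\colon R\times_B R\times_A R\to A\times B$ factors through $(f,g)\colon R\to A\times B$, where $R\times_B R\times_A R$ is the object of triples $(r_1,r_2,r_3)$ with $g r_1=g r_2$ and $f r_2=f r_3$. A finitely complete category is *diexact* if every Mal'cev span in it has a pushout, and every such pushout square is stable under pullback and is itself a pullback square. A *pretopos* is a finitely complete category that is both (finitary) extensive and Barr-exact, that is, regular with every equivalence relation a kernel pair. **Theorem.** A finitely complete category is a pretopos if and only if it is diexact and has a strict initial object. -/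

import Mathlib

universe v u

open CategoryTheory CategoryTheory.Limits

namespace Diexactness

variable {C : Type u} [Category.{v} C]

/-- A Mal'cev (difunctional) span: a jointly monic span `A ⟵f- R -g⟶ B` for which
`(f π₁, g π₃) : R ×_B R ×_A R ⟶ A, B` factors through `(f, g)`. The triple fibre product is the
iterated pullback of `(r₁, r₂, r₃)` with `g r₁ = g r₂` and `f r₂ = f r₃`. -/
structure IsMalcevSpan [HasPullbacks C] {R A B : C} (f : R ⟶ A) (g : R ⟶ B) : Prop where
  jointlyMono : JointlyMono₂ f g
  exists_factor : ∃ m : pullback (pullback.snd g g ≫ f) f ⟶ R,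
    m ≫ f = pullback.fst (pullback.snd g g ≫ f) f ≫ pullback.fst g g ≫ f ∧
    m ≫ g = pullback.snd (pullback.snd g g ≫ f) f ≫ g

/-- A pushout square with sides `f, g, h, k` and corner `Z` is stable under pullback if, for every
morphism `δ : Z' ⟶ Z`, the square obtained by pulling it back along `δ` is again a pushout. In the
commutative cube below, `h'`, `k'` and `f'`, `g'` are the pullbacks of `h`, `k` and `f`, `g`. -/
def IsStablePushout {W X Y Z : C} (f : W ⟶ X) (g : W ⟶ Y) (h : X ⟶ Z) (k : Y ⟶ Z) : Prop :=
  IsPushout f g h k ∧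
  ∀ ⦃W' X' Y' Z' : C⦄ (f' : W' ⟶ X') (g' : W' ⟶ Y') (h' : X' ⟶ Z') (k' : Y' ⟶ Z')
    (ω : W' ⟶ W) (α : X' ⟶ X) (β : Y' ⟶ Y) (δ : Z' ⟶ Z),
    IsPullback h' α δ h → IsPullback k' β δ k →
    IsPullback f' ω α f → IsPullback g' ω β g →
    CommSq f' g' h' k' → IsPushout f' g' h' k'

variable (C)

/-- A finitely complete category is diexact if it has pushouts of Mal'cev spans, and every such
pushout square is stable under pullback and is itself a pullback square. -/
structure IsDiexact [HasFiniteLimits C] : Prop where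
  hasPushout : ∀ {R A B : C} (f : R ⟶ A) (g : R ⟶ B), IsMalcevSpan f g → HasPushout f g
  isStablePushout : ∀ {R A B D : C} (f : R ⟶ A) (g : R ⟶ B) (h : A ⟶ D) (k : B ⟶ D),
    IsMalcevSpan f g → IsPushout f g h k → IsStablePushout f g h k
  isPullback : ∀ {R A B D : C} (f : R ⟶ A) (g : R ⟶ B) (h : A ⟶ D) (k : B ⟶ D),
    IsMalcevSpan f g → IsPushout f g h k → IsPullback f g h k

/-- A category is Barr-exact if it is regular and every (internal) equivalence relation in it is
the kernel pair of some morphism. -/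
structure IsBarrExact : Prop where
  regular : Regular C
  exists_isKernelPair : ∀ {R A : C} (s t : R ⟶ A), IsEquivalenceRelation s t →
    ∃ (Q : C) (q : A ⟶ Q), IsKernelPair q s t

/-- A pretopos is a finitely complete category which is (finitary) extensive and Barr-exact. -/
structure IsPretopos [HasFiniteLimits C] : Prop where
  extensive : FinitaryExtensive C
  barrExact : IsBarrExact C

end Diexactness

/-!
# Pretoposes are diexact categories with a strict initial object

**From diexactness to pretopos.** When the initial object is strict, every span `A ← 0 → B` is
Mal'cev. Its pushout is the coproduct of `A` and `B`; stability of the pushout says that coproducts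
are universal, and the pullback property says that they are disjoint, which together give
extensivity (`IsDiexact.finitaryExtensive`). An equivalence relation `s, t : R ⟶ A` is a Mal'cev
span, and by reflexivity a pushout of it is the same thing as a coequalizer, so `R` has a stable
quotient of which it is the kernel pair (`IsDiexact.isBarrExact`).

**From pretopos to diexactness.** A pretopos has a subcanonical coherent topology, in which regular
epimorphisms and coproduct inclusions are covers. Working locally for this topology, generalized
elements behave like elements of sets. For a Mal'cev span `f : A ⟵ R ⟶ B : g`, the quotient of
`A ⨿ B` which glues the two ends of each element of `R` should be the pushout. The Mal'cev condition
makes the relation `GlueRel f g` on generalized elements of `A ⨿ B` locally transitive; it is the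
image of a pair of morphisms, hence an equivalence relation in the category, and exactness provides
an effective quotient (`exists_quotient_glueRel`). The resulting square satisfies the four local
conditions `IsLocalPushout`. These imply, over any subcanonical site, that the square is a pushout
(descended morphisms are glued by the sheaf property of representables) and, for a jointly monic
span, a pullback. Being local conditions on elements they are inherited by pulled back squares,
which is why the pushout is stable.
-/

namespace Diexactness

variable {C : Type u} [Category.{v} C]

/-! ### Local reasoning about generalized elements -/

section Locally

variable {J : GrothendieckTopology C}

/-- A property of morphisms into `T` holds locally if it holds for all members of some covering
sieve. Properties are written as `fun U u => _`, where `u : U ⟶ T` is the restriction. -/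
def Locally (J : GrothendieckTopology C) {T : C} (P : ∀ U : C, (U ⟶ T) → Prop) : Prop :=
  ∃ S ∈ J T, ∀ (U : C) (u : U ⟶ T), S u → P U u

theorem Locally.of_forall {T : C} {P : ∀ U : C, (U ⟶ T) → Prop} (h : ∀ U u, P U u) :
    Locally J P :=
  ⟨⊤, J.top_mem T, fun U u _ => h U u⟩

theorem Locally.bind {T : C} {P Q : ∀ U : C, (U ⟶ T) → Prop} (hP : Locally J P)
    (h : ∀ U u, P U u → Locally J (fun V (w : V ⟶ U) => Q V (w ≫ u))) : Locally J Q := by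
  obtain ⟨S, hS, hSP⟩ := hP
  choose R hR hRQ using fun (U : C) (u : U ⟶ T) (hu : S u) => h U u (hSP U u hu)
  refine ⟨_, J.bind_covering hS (R := fun _ _ hu => R _ _ hu) (fun _ _ hu => hR _ _ hu), ?_⟩
  rintro V - ⟨U, w, u, hu, hw, rfl⟩
  exact hRQ U u hu V w hw

theorem Locally.mono {T : C} {P Q : ∀ U : C, (U ⟶ T) → Prop} (hP : Locally J P)
    (h : ∀ U u, P U u → Q U u) : Locally J Q := by
  obtain ⟨S, hS, hSP⟩ := hP
  exact ⟨S, hS, fun U u hu => h U u (hSP U u hu)⟩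

theorem Locally.restrict {T T' : C} {P : ∀ U : C, (U ⟶ T) → Prop} (hP : Locally J P)
    (t : T' ⟶ T) : Locally J (fun U (u : U ⟶ T') => P U (u ≫ t)) := by
  obtain ⟨S, hS, hSP⟩ := hP
  exact ⟨S.pullback t, J.pullback_stable t hS, fun U u hu => hSP U _ hu⟩

variable [J.Subcanonical]

theorem Locally.hom_ext {T Z : C} {x y : T ⟶ Z} (h : Locally J (fun _ u => u ≫ x = u ≫ y)) :
    x = y := by
  obtain ⟨S, hS, hSP⟩ := h
  have := GrothendieckTopology.Subcanonical.isSheaf_of_isRepresentable (J := J) (yoneda.obj Z)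
  exact (this S hS).isSeparatedFor.ext (t₁ := x) (t₂ := y) fun U u hu => hSP U u hu

/-- A pair of morphisms which locally factors through a jointly monic span does so globally. -/
theorem Locally.exists_lift {R A B T : C} {f : R ⟶ A} {g : R ⟶ B} (hfg : JointlyMono₂ f g)
    {a : T ⟶ A} {b : T ⟶ B}
    (h : Locally J (fun U u => ∃ r : U ⟶ R, r ≫ f = u ≫ a ∧ r ≫ g = u ≫ b)) :
    ∃ r : T ⟶ R, r ≫ f = a ∧ r ≫ g = b := by
  obtain ⟨S, hS, hSP⟩ := h
  have hR := GrothendieckTopology.Subcanonical.isSheaf_of_isRepresentable (J := J)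
    (yoneda.obj R) S hS
  choose r hrf hrg using hSP
  let x : Presieve.FamilyOfElements (yoneda.obj R) (S : Presieve T) := fun U u hu => r U u hu
  have hx : x.Compatible := by
    rw [Presieve.compatible_iff_sieveCompatible]
    intro U V u w hu
    refine hfg.right_cancellation _ _ ?_ ?_
    · change r _ _ _ ≫ f = (w ≫ r _ _ _) ≫ f
      simp [hrf]
    · change r _ _ _ ≫ g = (w ≫ r _ _ _) ≫ g
      simp [hrg]
  have hr : ∀ (U : C) (u : U ⟶ T) (hu : S u), u ≫ (hR.amalgamate x hx : T ⟶ R) = r U u hu :=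
    fun U u hu => hR.valid_glue hx u hu
  refine ⟨hR.amalgamate x hx, Locally.hom_ext (J := J) ⟨S, hS, fun U u hu => ?_⟩,
    Locally.hom_ext (J := J) ⟨S, hS, fun U u hu => ?_⟩⟩
  · exact (Category.assoc _ _ _).symm.trans ((hr U u hu =≫ f).trans (hrf U u hu))
  · exact (Category.assoc _ _ _).symm.trans ((hr U u hu =≫ g).trans (hrg U u hu))

end Locally

/-! ### A local criterion for pushout squares -/

section LocalPushout

variable {J : GrothendieckTopology C} {R A B D : C}

/-- Locally, two elements of `A` identified by `h : A ⟶ D` are either equal or linked by a pair of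
elements of `R` with the same image under `g`. -/
def IsLocallyLinked (J : GrothendieckTopology C) (f : R ⟶ A) (g : R ⟶ B) (h : A ⟶ D) : Prop :=
  ∀ ⦃T : C⦄ (a a' : T ⟶ A), a ≫ h = a' ≫ h → Locally J (fun U u => u ≫ a = u ≫ a' ∨
    ∃ r r' : U ⟶ R, r ≫ f = u ≫ a ∧ r' ≫ f = u ≫ a' ∧ r ≫ g = r' ≫ g)

/-- A commutative square which, in the internal logic of the site `(C, J)`, exhibits `D` as the
quotient of the disjoint union of `A` and `B` by the least identifications making it commute:
every element of `D` comes from `A` or `B`, and any identification in `D` is witnessed by at most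
two elements of `R`. -/
structure IsLocalPushout (J : GrothendieckTopology C) (f : R ⟶ A) (g : R ⟶ B) (h : A ⟶ D)
    (k : B ⟶ D) : Prop where
  w : f ≫ h = g ≫ k
  cover : ∀ ⦃T : C⦄ (t : T ⟶ D), Locally J (fun U u =>
    (∃ a : U ⟶ A, a ≫ h = u ≫ t) ∨ ∃ b : U ⟶ B, b ≫ k = u ≫ t)
  left : IsLocallyLinked J f g h
  right : IsLocallyLinked J g f k
  mixed : ∀ ⦃T : C⦄ (a : T ⟶ A) (b : T ⟶ B), a ≫ h = b ≫ k →
    Locally J (fun U u => ∃ r : U ⟶ R, r ≫ f = u ≫ a ∧ r ≫ g = u ≫ b)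

variable {f : R ⟶ A} {g : R ⟶ B} {h : A ⟶ D} {k : B ⟶ D}

theorem IsLocallyLinked.comp_eq [J.Subcanonical] (H : IsLocallyLinked J f g h) {Z T : C}
    {x : A ⟶ Z} {y : B ⟶ Z} (hxy : f ≫ x = g ≫ y) {a a' : T ⟶ A} (ha : a ≫ h = a' ≫ h) :
    a ≫ x = a' ≫ x := by
  refine Locally.hom_ext (J := J) ((H a a' ha).mono fun U u hu => ?_)
  rcases hu with hu | ⟨r, r', hr, hr', e⟩
  · rw [← Category.assoc, hu, Category.assoc]
  · rw [← Category.assoc, ← Category.assoc, ← hr, ← hr', Category.assoc, Category.assoc, hxy,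
      ← Category.assoc, e, Category.assoc]

theorem IsLocalPushout.exists_desc [J.Subcanonical] (H : IsLocalPushout J f g h k) {Z : C}
    {x : A ⟶ Z} {y : B ⟶ Z} (hxy : f ≫ x = g ≫ y) : ∃ d : D ⟶ Z, h ≫ d = x ∧ k ≫ d = y := by
  have hmix : ∀ ⦃T : C⦄ (a : T ⟶ A) (b : T ⟶ B), a ≫ h = b ≫ k → a ≫ x = b ≫ y := by
    intro T a b hab
    refine Locally.hom_ext (J := J) ((H.mixed a b hab).mono ?_)
    rintro U u ⟨r, hr, hr'⟩
    rw [← Category.assoc, ← Category.assoc, ← hr, ← hr', Category.assoc, Category.assoc, hxy]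
  -- `V u z` says that `z` is the value which a descended morphism `D ⟶ Z` must take at `u`.
  let V : ∀ {U : C}, (U ⟶ D) → (U ⟶ Z) → Prop := fun {U} u z =>
    (∃ a : U ⟶ A, a ≫ h = u ∧ z = a ≫ x) ∨ ∃ b : U ⟶ B, b ≫ k = u ∧ z = b ≫ y
  have hV : ∀ {U : C} {u : U ⟶ D} {z z' : U ⟶ Z}, V u z → V u z' → z = z' := by
    rintro U u z z' (⟨a, rfl, rfl⟩ | ⟨b, rfl, rfl⟩) (⟨a', h', rfl⟩ | ⟨b', h', rfl⟩)
    · exact H.left.comp_eq hxy h'.symm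
    · exact hmix _ _ h'.symm
    · exact (hmix _ _ h').symm
    · exact H.right.comp_eq hxy.symm h'.symm
  have hVc : ∀ {U U' : C} {u : U ⟶ D} {z : U ⟶ Z} (w : U' ⟶ U), V u z → V (w ≫ u) (w ≫ z) := by
    rintro U U' u z w (⟨a, rfl, rfl⟩ | ⟨b, rfl, rfl⟩)
    · exact Or.inl ⟨w ≫ a, by simp, by simp⟩
    · exact Or.inr ⟨w ≫ b, by simp, by simp⟩
  let S : Sieve D :=
    { arrows := fun U u => ∃ z : U ⟶ Z, V u z
      downward_closed := fun {_ _ _} ⟨z, hz⟩ w => ⟨w ≫ z, hVc w hz⟩ }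
  have hS : S ∈ J D := by
    obtain ⟨S', hS', hSP⟩ := H.cover (𝟙 D)
    refine J.superset_covering (fun U u hu => ?_) hS'
    rcases hSP U u hu with ⟨a, ha⟩ | ⟨b, hb⟩
    · exact ⟨a ≫ x, Or.inl ⟨a, by simpa using ha, rfl⟩⟩
    · exact ⟨b ≫ y, Or.inr ⟨b, by simpa using hb, rfl⟩⟩
  have hZ := GrothendieckTopology.Subcanonical.isSheaf_of_isRepresentable (J := J)
    (yoneda.obj Z) S hS
  choose z hz using fun (U : C) (u : U ⟶ D) (hu : S u) => (hu : ∃ z : U ⟶ Z, V u z)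
  let F : Presieve.FamilyOfElements (yoneda.obj Z) (S : Presieve D) := fun U u hu => z U u hu
  have hF : F.Compatible := by
    rw [Presieve.compatible_iff_sieveCompatible]
    intro U U' u w hu
    exact hV (hz _ _ _) (hVc w (hz U u hu))
  have hd : ∀ (U : C) (u : U ⟶ D) (hu : S u), u ≫ (hZ.amalgamate F hF : D ⟶ Z) = z U u hu :=
    fun U u hu => hZ.valid_glue hF u hu
  have hh : V h x := Or.inl ⟨𝟙 A, by simp, by simp⟩
  have hk : V k y := Or.inr ⟨𝟙 B, by simp, by simp⟩
  exact ⟨hZ.amalgamate F hF, (hd A h ⟨x, hh⟩).trans (hV (hz _ _ _) hh),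
    (hd B k ⟨y, hk⟩).trans (hV (hz _ _ _) hk)⟩

theorem IsLocalPushout.isPushout [J.Subcanonical] (H : IsLocalPushout J f g h k) :
    IsPushout f g h k := by
  refine ⟨⟨H.w⟩, ⟨PushoutCocone.IsColimit.mk H.w
    (fun s => (H.exists_desc s.condition).choose)
    (fun s => (H.exists_desc s.condition).choose_spec.1)
    (fun s => (H.exists_desc s.condition).choose_spec.2) (fun s m hm hm' => ?_)⟩⟩
  obtain ⟨e, e'⟩ := (H.exists_desc s.condition).choose_spec
  refine Locally.hom_ext (J := J) ((H.cover (𝟙 D)).mono fun U u hu => ?_)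
  simp only [Category.comp_id] at hu
  rcases hu with ⟨a, rfl⟩ | ⟨b, rfl⟩
  · rw [Category.assoc, Category.assoc, hm, e]
  · rw [Category.assoc, Category.assoc, hm', e']

theorem IsLocallyLinked.of_isPullback (H : IsLocallyLinked J f g h) {R' A' B' D' : C}
    {f' : R' ⟶ A'} {g' : R' ⟶ B'} {h' : A' ⟶ D'} {k' : B' ⟶ D'} {ω : R' ⟶ R} {α : A' ⟶ A}
    {β : B' ⟶ B} {δ : D' ⟶ D} (hh : IsPullback h' α δ h) (hk : IsPullback k' β δ k)
    (hf : IsPullback f' ω α f) (hg : IsPullback g' ω β g) (w : f' ≫ h' = g' ≫ k') :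
    IsLocallyLinked J f' g' h' := by
  intro T a a' haa'
  have := H (a ≫ α) (a' ≫ α) (by
    rw [Category.assoc, Category.assoc, ← hh.w, reassoc_of% haa'])
  refine this.mono fun U u hu => ?_
  rcases hu with hu | ⟨r, r', hr, hr', e⟩
  · left
    refine hh.hom_ext ?_ ?_
    · rw [Category.assoc, haa', Category.assoc]
    · simpa using hu
  · right
    refine ⟨hf.lift (u ≫ a) r (by simp [hr]), hf.lift (u ≫ a') r' (by simp [hr']),
      by simp, by simp, hk.hom_ext ?_ ?_⟩
    · simp only [Category.assoc, ← w, hf.lift_fst_assoc, haa']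
    · simp only [Category.assoc, hg.w, hf.lift_snd_assoc, e]

theorem IsLocalPushout.of_isPullback (H : IsLocalPushout J f g h k) {R' A' B' D' : C}
    {f' : R' ⟶ A'} {g' : R' ⟶ B'} {h' : A' ⟶ D'} {k' : B' ⟶ D'} {ω : R' ⟶ R} {α : A' ⟶ A}
    {β : B' ⟶ B} {δ : D' ⟶ D} (hh : IsPullback h' α δ h) (hk : IsPullback k' β δ k)
    (hf : IsPullback f' ω α f) (hg : IsPullback g' ω β g) (w : f' ≫ h' = g' ≫ k') :
    IsLocalPushout J f' g' h' k' where
  w := w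
  left := H.left.of_isPullback hh hk hf hg w
  right := H.right.of_isPullback hk hh hg hf w.symm
  cover T t := (H.cover (t ≫ δ)).mono fun U u hu => by
    rcases hu with ⟨a, ha⟩ | ⟨b, hb⟩
    · exact Or.inl ⟨hh.lift (u ≫ t) a (by simp [ha]), by simp⟩
    · exact Or.inr ⟨hk.lift (u ≫ t) b (by simp [hb]), by simp⟩
  mixed T a b hab := by
    have := H.mixed (a ≫ α) (b ≫ β) (by
      rw [Category.assoc, Category.assoc, ← hh.w, ← hk.w, reassoc_of% hab])
    refine this.mono ?_
    rintro U u ⟨r, hr, hr'⟩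
    refine ⟨hf.lift (u ≫ a) r (by simp [hr]), by simp, hk.hom_ext ?_ ?_⟩
    · rw [Category.assoc, ← w, hf.lift_fst_assoc, Category.assoc, hab, Category.assoc]
    · rw [Category.assoc, hg.w, hf.lift_snd_assoc, hr', Category.assoc]

/-- A local pushout square of a jointly monic span is a pullback square. -/
theorem IsLocalPushout.isPullback [J.Subcanonical] (H : IsLocalPushout J f g h k)
    (hfg : JointlyMono₂ f g) : IsPullback f g h k := by
  have hl := fun s : PullbackCone h k =>
    Locally.exists_lift hfg (H.mixed s.fst s.snd s.condition)
  refine ⟨⟨H.w⟩, ⟨PullbackCone.IsLimit.mk H.w (fun s => (hl s).choose)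
    (fun s => (hl s).choose_spec.1) (fun s => (hl s).choose_spec.2) fun s m hm hm' =>
      hfg.right_cancellation _ _ (hm.trans (hl s).choose_spec.1.symm)
        (hm'.trans (hl s).choose_spec.2.symm)⟩⟩

theorem IsLocalPushout.isStablePushout [J.Subcanonical] (H : IsLocalPushout J f g h k) :
    IsStablePushout f g h k :=
  ⟨H.isPushout, fun _ _ _ _ _ _ _ _ _ _ _ _ hh hk hf hg hw =>
    (H.of_isPullback hh hk hf hg hw.w).isPushout⟩

theorem IsLocalPushout.of_iso {D' : C} (H : IsLocalPushout J f g h k) (e : D ≅ D') :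
    IsLocalPushout J f g (h ≫ e.hom) (k ≫ e.hom) where
  w := by rw [reassoc_of% H.w]
  left T a a' haa' := H.left a a' (by simpa [← Category.assoc] using haa')
  right T b b' hbb' := H.right b b' (by simpa [← Category.assoc] using hbb')
  mixed T a b hab := H.mixed a b (by simpa [← Category.assoc] using hab)
  cover T t := (H.cover (t ≫ e.inv)).mono fun U u hu => by
    rcases hu with ⟨a, ha⟩ | ⟨b, hb⟩
    · exact Or.inl ⟨a, by rw [reassoc_of% ha]; simp⟩
    · exact Or.inr ⟨b, by rw [reassoc_of% hb]; simp⟩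

end LocalPushout

/-! ### The coherent topology of a pretopos -/

section Coherent

variable [Regular C] [FinitaryExtensive C]

theorem locally_exists_lift_of_isRegularEpi {X Y T : C} (p : X ⟶ Y) [IsRegularEpi p] (t : T ⟶ Y) :
    Locally (coherentTopology C) (fun U u => ∃ x : U ⟶ X, x ≫ p = u ≫ t) := by
  let S : Sieve T :=
    { arrows := fun U u => ∃ x : U ⟶ X, x ≫ p = u ≫ t
      downward_closed := fun {_ _ _} ⟨x, hx⟩ w => ⟨w ≫ x, by simp [hx]⟩ }
  refine ⟨S, coherentTopology.mem_sieves_of_hasEffectiveEpiFamily S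
    ⟨Unit, inferInstance, fun _ => pullback p t, fun _ => pullback.snd p t, inferInstance,
      fun _ => ⟨pullback.fst p t, pullback.condition⟩⟩, fun U u hu => hu⟩

theorem locally_inl_or_inr {A B T : C} (t : T ⟶ A ⨿ B) :
    Locally (coherentTopology C) (fun U u =>
      (∃ a : U ⟶ A, a ≫ coprod.inl = u ≫ t) ∨ ∃ b : U ⟶ B, b ≫ coprod.inr = u ≫ t) := by
  let S : Sieve (A ⨿ B) :=
    { arrows := fun U u =>
        (∃ a : U ⟶ A, a ≫ coprod.inl = u) ∨ ∃ b : U ⟶ B, b ≫ coprod.inr = u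
      downward_closed := by
        rintro _ _ _ (⟨a, rfl⟩ | ⟨b, rfl⟩) w
        · exact Or.inl ⟨w ≫ a, by simp⟩
        · exact Or.inr ⟨w ≫ b, by simp⟩ }
  let X : Bool → C := fun i => Bool.rec A B i
  let π : ∀ i, X i ⟶ A ⨿ B := fun i => Bool.rec coprod.inl coprod.inr i
  have hπ : EffectiveEpiFamily X π := ⟨⟨
    { desc := fun e _ => coprod.desc (e false) (e true)
      fac := by
        rintro W e h (_ | _)
        · exact coprod.inl_desc _ _
        · exact coprod.inr_desc _ _
      uniq := by
        intro W e h m hm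
        refine coprod.hom_ext ?_ ?_
        · exact (hm false).trans (coprod.inl_desc _ _).symm
        · exact (hm true).trans (coprod.inr_desc _ _).symm }⟩⟩
  have hS : S ∈ coherentTopology C (A ⨿ B) :=
    coherentTopology.mem_sieves_of_hasEffectiveEpiFamily S ⟨Bool, inferInstance, X, π, hπ, by
      rintro (_ | _)
      · exact Or.inl ⟨𝟙 A, Category.id_comp _⟩
      · exact Or.inr ⟨𝟙 B, Category.id_comp _⟩⟩
  exact ⟨S.pullback t, (coherentTopology C).pullback_stable t hS, fun U u hu => hu⟩

/-- Coproducts are disjoint: an object over both summands is initial. -/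
noncomputable def isInitialOfInlEqInr {A B T : C} {a : T ⟶ A} {b : T ⟶ B}
    (hab : a ≫ (coprod.inl : A ⟶ A ⨿ B) = b ≫ coprod.inr) : IsInitial T :=
  (initialIsInitial (C := C)).ofIso (asIso ((FinitaryExtensive.isPullback_initial_to_binaryCofan
    (coprodIsCoprod A B)).lift a b hab)).symm

/-- The image of a pair `w₁, w₂ : W ⟶ X`, as a jointly monic pair. Two elements of `X` are related
by it when they are locally in the image. -/
theorem exists_image_relation {W X : C} (w₁ w₂ : W ⟶ X) :
    ∃ (E : C) (p₁ p₂ : E ⟶ X), JointlyMono₂ p₁ p₂ ∧ ∀ ⦃T : C⦄ (x y : T ⟶ X),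
      (∃ e : T ⟶ E, e ≫ p₁ = x ∧ e ≫ p₂ = y) ↔ Locally (coherentTopology C)
        (fun U u => ∃ w : U ⟶ W, w ≫ w₁ = u ≫ x ∧ w ≫ w₂ = u ≫ y) := by
  let F := Regular.strongEpiMonoFactorisation (prod.lift w₁ w₂)
  have : IsRegularEpi F.e := by infer_instance
  have hm : JointlyMono₂ (F.m ≫ prod.fst) (F.m ≫ prod.snd) := ⟨fun Y a b h₁ h₂ => by
    rw [← cancel_mono F.m]
    exact Limits.prod.hom_ext (by simpa using h₁) (by simpa using h₂)⟩
  have h₁ : F.e ≫ F.m ≫ prod.fst = w₁ := by rw [F.fac_assoc, prod.lift_fst]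
  have h₂ : F.e ≫ F.m ≫ prod.snd = w₂ := by rw [F.fac_assoc, prod.lift_snd]
  refine ⟨F.I, F.m ≫ prod.fst, F.m ≫ prod.snd, hm, fun T x y => ⟨?_, fun h => ?_⟩⟩
  · rintro ⟨e, rfl, rfl⟩
    refine (locally_exists_lift_of_isRegularEpi F.e e).mono ?_
    rintro U u ⟨w, hw⟩
    have hw_assoc := fun {Y : C} (z : F.I ⟶ Y) => (reassoc_of% hw) z
    exact ⟨w, (w ≫= h₁.symm).trans (hw_assoc _),
      (w ≫= h₂.symm).trans (hw_assoc _)⟩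
  · refine Locally.exists_lift hm (h.mono ?_)
    rintro U u ⟨w, hw₁, hw₂⟩
    exact ⟨w ≫ F.e, by rw [Category.assoc, h₁, hw₁], by rw [Category.assoc, h₂, hw₂]⟩

end Coherent

/-! ### The equivalence relation generated by a Mal'cev span -/

section Linked

variable {R A B T : C}

/-- Two elements `r₁, r₂` of a span `(f, g)` are linked if the span relates the source of `r₁` to
the target of `r₂`. -/
def Linked (f : R ⟶ A) (g : R ⟶ B) (r₁ r₂ : T ⟶ R) : Prop :=
  ∃ r : T ⟶ R, r ≫ f = r₁ ≫ f ∧ r ≫ g = r₂ ≫ g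

variable {f : R ⟶ A} {g : R ⟶ B} {r₁ r₂ r₃ : T ⟶ R}

theorem Linked.restrict (h : Linked f g r₁ r₂) {U : C} (u : U ⟶ T) :
    Linked f g (u ≫ r₁) (u ≫ r₂) := by
  obtain ⟨r, hr, hr'⟩ := h
  exact ⟨u ≫ r, by simp [hr], by simp [hr']⟩

theorem Linked.of_fst (h : r₁ ≫ f = r₂ ≫ f) : Linked f g r₁ r₂ := ⟨r₂, h.symm, rfl⟩

theorem Linked.of_snd (h : r₁ ≫ g = r₂ ≫ g) : Linked f g r₁ r₂ := ⟨r₁, rfl, h⟩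

/-- The Mal'cev condition in terms of generalized elements. -/
theorem IsMalcevSpan.exists_of_eq [HasPullbacks C] (hR : IsMalcevSpan f g) (h : r₁ ≫ g = r₂ ≫ g)
    (h' : r₂ ≫ f = r₃ ≫ f) : ∃ r : T ⟶ R, r ≫ f = r₁ ≫ f ∧ r ≫ g = r₃ ≫ g := by
  obtain ⟨m, hm, hm'⟩ := hR.exists_factor
  exact ⟨pullback.lift (pullback.lift r₁ r₂ h) r₃ (by rwa [pullback.lift_snd_assoc]) ≫ m,
    by rw [Category.assoc, hm, pullback.lift_fst_assoc, pullback.lift_fst_assoc],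
    by rw [Category.assoc, hm', pullback.lift_snd_assoc]⟩

theorem IsMalcevSpan.linked_symm [HasPullbacks C] (hR : IsMalcevSpan f g)
    (h : Linked f g r₁ r₂) : Linked f g r₂ r₁ := by
  obtain ⟨r, hr, hr'⟩ := h
  exact hR.exists_of_eq hr'.symm hr

theorem IsMalcevSpan.linked_trans [HasPullbacks C] (hR : IsMalcevSpan f g)
    (h : Linked f g r₁ r₂) (h' : Linked f g r₂ r₃) : Linked f g r₁ r₃ := by
  obtain ⟨r, hr, hr'⟩ := h
  obtain ⟨t, ht, ht'⟩ := h'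
  obtain ⟨s, hs, hs'⟩ := hR.exists_of_eq hr' ht.symm
  exact ⟨s, hs.trans hr, hs'.trans ht'⟩

end Linked

section Glue

variable [FinitaryExtensive C] {R A B T : C} {f : R ⟶ A} {g : R ⟶ B}

/-- The relation on `A ⨿ B` which identifies the two ends of each element of `R`. Elements of
`R ⨿ R` are viewed as elements of `R` with a choice of one of their ends: `coprod.map f g` is the
chosen end, and the codiagonal forgets the choice. -/
def GlueRel (f : R ⟶ A) (g : R ⟶ B) (x y : T ⟶ A ⨿ B) : Prop :=
  x = y ∨ ∃ s s' : T ⟶ R ⨿ R, s ≫ coprod.map f g = x ∧ s' ≫ coprod.map f g = y ∧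
    Linked f g (s ≫ codiag R) (s' ≫ codiag R)

theorem GlueRel.restrict {x y : T ⟶ A ⨿ B} (h : GlueRel f g x y) {U : C} (u : U ⟶ T) :
    GlueRel f g (u ≫ x) (u ≫ y) := by
  rcases h with rfl | ⟨s, s', rfl, rfl, h⟩
  · exact Or.inl rfl
  · exact Or.inr ⟨u ≫ s, u ≫ s', by simp, by simp, by simpa using h.restrict u⟩

variable [Regular C]

/-- Elements of `R` sharing a chosen end are linked: a common end in `A` or in `B` gives a link at
once, and an end in `A` never equals an end in `B` unless the domain is initial. -/
theorem locally_linked_of_eq {s s' : T ⟶ R ⨿ R}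
    (h : s ≫ coprod.map f g = s' ≫ coprod.map f g) :
    Locally (coherentTopology C)
      (fun _ u => Linked f g (u ≫ s ≫ codiag R) (u ≫ s' ≫ codiag R)) := by
  refine (locally_inl_or_inr s).bind fun U u hu => (locally_inl_or_inr (u ≫ s')).mono
    fun V w hw => ?_
  have h' : (w ≫ u ≫ s) ≫ coprod.map f g = (w ≫ u ≫ s') ≫ coprod.map f g := by
    simp only [Category.assoc, h]
  suffices Linked f g ((w ≫ u ≫ s) ≫ codiag R) ((w ≫ u ≫ s') ≫ codiag R) by simpa using this
  rcases hu with ⟨r, hr⟩ | ⟨r, hr⟩ <;> rcases hw with ⟨r', hr'⟩ | ⟨r', hr'⟩ <;>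
    rw [← hr, ← hr'] at h' ⊢ <;>
    simp only [Category.assoc, coprod.inl_map, coprod.inr_map, coprod.inl_desc,
      coprod.inr_desc, Category.comp_id] at h' ⊢ <;>
    rw [← Category.assoc, ← Category.assoc, ← Category.assoc] at h'
  · exact Linked.of_fst ((cancel_mono _).1 h')
  · exact Linked.of_fst ((isInitialOfInlEqInr h').hom_ext _ _)
  · exact Linked.of_fst ((isInitialOfInlEqInr h'.symm).hom_ext _ _)
  · exact Linked.of_snd ((cancel_mono _).1 h')

theorem GlueRel.symm (hR : IsMalcevSpan f g) {x y : T ⟶ A ⨿ B} (h : GlueRel f g x y) :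
    GlueRel f g y x := by
  rcases h with rfl | ⟨s, s', hs, hs', h⟩
  · exact Or.inl rfl
  · exact Or.inr ⟨s', s, hs', hs, hR.linked_symm h⟩

theorem GlueRel.locally_trans (hR : IsMalcevSpan f g) {x y z : T ⟶ A ⨿ B}
    (h : GlueRel f g x y) (h' : GlueRel f g y z) :
    Locally (coherentTopology C) (fun _ u => GlueRel f g (u ≫ x) (u ≫ z)) := by
  rcases h with rfl | ⟨s₁, s₂, rfl, hs₂, h⟩
  · exact .of_forall fun U u => h'.restrict u
  rcases h' with rfl | ⟨s₃, s₄, hs₃, rfl, h'⟩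
  · exact .of_forall fun U u => Or.inr ⟨u ≫ s₁, u ≫ s₂, by simp, by simp [hs₂],
      by simpa using h.restrict u⟩
  refine (locally_linked_of_eq (hs₂.trans hs₃.symm)).mono fun U u hu => ?_
  refine Or.inr ⟨u ≫ s₁, u ≫ s₄, by simp, by simp, ?_⟩
  simpa using hR.linked_trans (hR.linked_trans (h.restrict u) hu) (h'.restrict u)

/-- `GlueRel f g` is, locally, the image of a pair of morphisms. -/
theorem exists_span_glueRel (f : R ⟶ A) (g : R ⟶ B) :
    ∃ (W : C) (w₁ w₂ : W ⟶ A ⨿ B), ∀ ⦃T : C⦄ (x y : T ⟶ A ⨿ B),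
      Locally (coherentTopology C)
        (fun U u => ∃ w : U ⟶ W, w ≫ w₁ = u ≫ x ∧ w ≫ w₂ = u ≫ y) ↔
      Locally (coherentTopology C) (fun _ u => GlueRel f g (u ≫ x) (u ≫ y)) := by
  -- `Z` classifies triples `(s, r, s')` where `r` links the elements of `R` under `s` and `s'`.
  obtain ⟨Z, z₁, z, z₂, hz₁, hz₂, hZ⟩ : ∃ (Z : C) (z₁ : Z ⟶ R ⨿ R) (z : Z ⟶ R)
      (z₂ : Z ⟶ R ⨿ R), z ≫ f = z₁ ≫ codiag R ≫ f ∧ z ≫ g = z₂ ≫ codiag R ≫ g ∧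
      ∀ ⦃U : C⦄ (s s' : U ⟶ R ⨿ R), Linked f g (s ≫ codiag R) (s' ≫ codiag R) →
        ∃ t : U ⟶ Z, t ≫ z₁ = s ∧ t ≫ z₂ = s' := by
    refine ⟨pullback (pullback.snd (codiag R ≫ f) f ≫ g) (codiag R ≫ g),
      pullback.fst _ _ ≫ pullback.fst _ _, pullback.fst _ _ ≫ pullback.snd _ _,
      pullback.snd _ _, ?_, ?_, ?_⟩
    · rw [Category.assoc, Category.assoc, pullback.condition (f := codiag R ≫ f) (g := f)]
    · rw [Category.assoc, pullback.condition]
    · rintro U s s' ⟨r, hr, hr'⟩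
      rw [Category.assoc] at hr hr'
      refine ⟨pullback.lift (pullback.lift s r hr.symm) s' ?_, ?_, ?_⟩
      · rw [pullback.lift_snd_assoc, hr']
      · rw [pullback.lift_fst_assoc, pullback.lift_fst]
      · rw [pullback.lift_snd]
  refine ⟨(A ⨿ B) ⨿ Z, coprod.desc (𝟙 _) (z₁ ≫ coprod.map f g),
    coprod.desc (𝟙 _) (z₂ ≫ coprod.map f g), fun T x y => ⟨fun h => h.bind ?_,
      fun h => h.mono ?_⟩⟩
  · rintro U u ⟨w, hw₁, hw₂⟩
    refine (locally_inl_or_inr w).mono ?_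
    rintro V v (⟨t, ht⟩ | ⟨t, ht⟩)
    · left
      rw [Category.assoc, Category.assoc, ← hw₁, ← hw₂, ← reassoc_of% ht, ← reassoc_of% ht,
        coprod.inl_desc, coprod.inl_desc]
    · right
      refine ⟨t ≫ z₁, t ≫ z₂, ?_, ?_, t ≫ z, ?_, ?_⟩
      · rw [Category.assoc, Category.assoc, ← hw₁, ← reassoc_of% ht, coprod.inr_desc]
      · rw [Category.assoc, Category.assoc, ← hw₂, ← reassoc_of% ht, coprod.inr_desc]
      · simp only [Category.assoc, hz₁]
      · simp only [Category.assoc, hz₂]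
  · rintro U u (hu | ⟨s, s', hs, hs', hl⟩)
    · refine ⟨(u ≫ x) ≫ coprod.inl, ?_, ?_⟩
      · rw [Category.assoc, coprod.inl_desc, Category.comp_id]
      · rw [Category.assoc, coprod.inl_desc, Category.comp_id, hu]
    · obtain ⟨t, rfl, rfl⟩ := hZ s s' hl
      refine ⟨t ≫ coprod.inr, ?_, ?_⟩
      · rw [← hs, Category.assoc, coprod.inr_desc, Category.assoc]
      · rw [← hs', Category.assoc, coprod.inr_desc, Category.assoc]

/-- In a pretopos, the relation `GlueRel f g` is realised by an effective quotient of `A ⨿ B`. -/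
theorem exists_quotient_glueRel (hC : IsBarrExact C) (hR : IsMalcevSpan f g) :
    ∃ (Q : C) (q : A ⨿ B ⟶ Q), IsRegularEpi q ∧ ∀ ⦃T : C⦄ (x y : T ⟶ A ⨿ B),
      x ≫ q = y ≫ q ↔ Locally (coherentTopology C) (fun _ u => GlueRel f g (u ≫ x) (u ≫ y)) := by
  obtain ⟨W, w₁, w₂, hW⟩ := exists_span_glueRel f g
  obtain ⟨E, p₁, p₂, hE, hEW⟩ := exists_image_relation w₁ w₂
  have key : ∀ ⦃T : C⦄ (x y : T ⟶ A ⨿ B), (∃ e : T ⟶ E, e ≫ p₁ = x ∧ e ≫ p₂ = y) ↔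
      Locally (coherentTopology C) (fun _ u => GlueRel f g (u ≫ x) (u ≫ y)) :=
    fun T x y => (hEW x y).trans (hW x y)
  obtain ⟨r, hr₁, hr₂⟩ := (key (𝟙 _) (𝟙 _)).2 (.of_forall fun _ _ => Or.inl rfl)
  obtain ⟨s, hs₁, hs₂⟩ := (key p₂ p₁).2
    (((key p₁ p₂).1 ⟨𝟙 E, by simp, by simp⟩).mono fun _ _ h => h.symm hR)
  obtain ⟨t, ht₁, ht₂⟩ := (key (pullback.fst p₂ p₁ ≫ p₁) (pullback.snd p₂ p₁ ≫ p₂)).2 (by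
    have h₁ := (key (pullback.fst p₂ p₁ ≫ p₁) (pullback.fst p₂ p₁ ≫ p₂)).1 ⟨_, rfl, rfl⟩
    have h₂ := (key (pullback.snd p₂ p₁ ≫ p₁) (pullback.snd p₂ p₁ ≫ p₂)).1 ⟨_, rfl, rfl⟩
    rw [pullback.condition] at h₁
    refine h₁.bind fun U u hu => (h₂.restrict u).bind fun V v hv => ?_
    refine (GlueRel.locally_trans hR (hu.restrict v) (by simpa using hv)).mono
      fun X x hx => by simpa using hx)
  have hEq : IsEquivalenceRelation p₁ p₂ := ⟨⟨
    { right_cancellation := hE.right_cancellation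
      r := r, reflexivity₁ := hr₁, reflexivity₂ := hr₂
      s := s, symmetry₁ := hs₁, symmetry₂ := hs₂
      c := PullbackCone.mk (pullback.fst p₂ p₁) (pullback.snd p₂ p₁) pullback.condition
      isLimit := pullbackIsPullback p₂ p₁
      t := t, transitivity₁ := ht₁, transitivity₂ := ht₂ }⟩⟩
  obtain ⟨Q', q', hq'⟩ := hC.exists_isKernelPair p₁ p₂ hEq
  have := Regular.hasCoequalizer_of_isKernelPair hq'
  have hq : IsKernelPair (coequalizer.π p₁ p₂) p₁ p₂ := by
    refine IsKernelPair.cancel_right (f₂ := coequalizer.desc q' hq'.w)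
      (coequalizer.condition p₁ p₂) ?_
    rwa [coequalizer.π_desc]
  refine ⟨coequalizer p₁ p₂, coequalizer.π p₁ p₂, inferInstance, fun T x y => ?_⟩
  rw [← key]
  refine ⟨fun h => ⟨hq.lift x y h, by simp, by simp⟩, ?_⟩
  rintro ⟨e, rfl, rfl⟩
  rw [Category.assoc, Category.assoc, coequalizer.condition]

end Glue

/-! ### A pretopos is diexact -/

section Pretopos

variable [Regular C] [FinitaryExtensive C] {R A B : C} {f : R ⟶ A} {g : R ⟶ B}

/-- If the chosen end of `s` lies in `A`, then it is locally the `A`-end of an element of `R`. -/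
theorem exists_inl_of_comp_map_eq {U : C} {s : U ⟶ R ⨿ R} {a : U ⟶ A}
    (h : s ≫ coprod.map f g = a ≫ coprod.inl) : Locally (coherentTopology C) (fun V v =>
      ∃ r : V ⟶ R, r ≫ f = v ≫ a ∧ r = v ≫ s ≫ codiag R) := by
  refine (locally_inl_or_inr s).mono ?_
  rintro V v (⟨r, hr⟩ | ⟨r, hr⟩)
  · refine ⟨r, ?_, ?_⟩
    · rw [← cancel_mono (coprod.inl : A ⟶ A ⨿ B), Category.assoc, Category.assoc, ← h,
        ← reassoc_of% hr, coprod.inl_map]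
    · rw [← reassoc_of% hr, coprod.inl_desc, Category.comp_id]
  · have h' : (v ≫ a) ≫ (coprod.inl : A ⟶ A ⨿ B) = (r ≫ g) ≫ coprod.inr := by
      rw [Category.assoc, Category.assoc, ← h, ← reassoc_of% hr, coprod.inr_map]
    exact ⟨r, (isInitialOfInlEqInr h').hom_ext _ _, (isInitialOfInlEqInr h').hom_ext _ _⟩

/-- If the chosen end of `s` lies in `B`, then it is locally the `B`-end of an element of `R`. -/
theorem exists_inr_of_comp_map_eq {U : C} {s : U ⟶ R ⨿ R} {b : U ⟶ B}
    (h : s ≫ coprod.map f g = b ≫ coprod.inr) : Locally (coherentTopology C) (fun V v =>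
      ∃ r : V ⟶ R, r ≫ g = v ≫ b ∧ r = v ≫ s ≫ codiag R) := by
  refine (locally_inl_or_inr s).mono ?_
  rintro V v (⟨r, hr⟩ | ⟨r, hr⟩)
  · have h' : (r ≫ f) ≫ (coprod.inl : A ⟶ A ⨿ B) = (v ≫ b) ≫ coprod.inr := by
      rw [Category.assoc, Category.assoc, ← h, ← reassoc_of% hr, coprod.inl_map]
    exact ⟨r, (isInitialOfInlEqInr h').hom_ext _ _, (isInitialOfInlEqInr h').hom_ext _ _⟩
  · refine ⟨r, ?_, ?_⟩
    · rw [← cancel_mono (coprod.inr : B ⟶ A ⨿ B), Category.assoc, Category.assoc, ← h,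
        ← reassoc_of% hr, coprod.inr_map]
    · rw [← reassoc_of% hr, coprod.inr_desc, Category.comp_id]

theorem GlueRel.locally_of_inl_inl {T : C} {a a' : T ⟶ A}
    (h : GlueRel f g (a ≫ coprod.inl) (a' ≫ coprod.inl)) :
    Locally (coherentTopology C) (fun U u => u ≫ a = u ≫ a' ∨
      ∃ r r' : U ⟶ R, r ≫ f = u ≫ a ∧ r' ≫ f = u ≫ a' ∧ r ≫ g = r' ≫ g) := by
  rcases h with h | ⟨s, s', hs, hs', hl⟩
  · rw [cancel_mono] at h
    exact .of_forall fun U u => Or.inl (by rw [h])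
  · refine (exists_inl_of_comp_map_eq hs).bind ?_
    rintro U u ⟨r, hr, e⟩
    refine ((exists_inl_of_comp_map_eq hs').restrict u).mono ?_
    rintro V v ⟨r', hr', e'⟩
    obtain ⟨t, ht, ht'⟩ := hl.restrict (v ≫ u)
    refine Or.inr ⟨t, r', ?_, hr', ?_⟩
    · rw [ht, Category.assoc v u, ← e, Category.assoc, Category.assoc, hr]
    · rw [ht', e']

theorem GlueRel.locally_of_inr_inr {T : C} {b b' : T ⟶ B}
    (h : GlueRel f g (b ≫ coprod.inr) (b' ≫ coprod.inr)) :
    Locally (coherentTopology C) (fun U u => u ≫ b = u ≫ b' ∨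
      ∃ r r' : U ⟶ R, r ≫ g = u ≫ b ∧ r' ≫ g = u ≫ b' ∧ r ≫ f = r' ≫ f) := by
  rcases h with h | ⟨s, s', hs, hs', hl⟩
  · rw [cancel_mono] at h
    exact .of_forall fun U u => Or.inl (by rw [h])
  · refine (exists_inr_of_comp_map_eq hs).bind ?_
    rintro U u ⟨r, hr, e⟩
    refine ((exists_inr_of_comp_map_eq hs').restrict u).mono ?_
    rintro V v ⟨r', hr', e'⟩
    obtain ⟨t, ht, ht'⟩ := hl.restrict (v ≫ u)
    refine Or.inr ⟨v ≫ r, t, by simp [hr], ?_, ?_⟩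
    · rw [ht', ← hr', e']
    · rw [ht, e, Category.assoc v u]

theorem GlueRel.locally_of_inl_inr {T : C} {a : T ⟶ A} {b : T ⟶ B}
    (h : GlueRel f g (a ≫ coprod.inl) (b ≫ coprod.inr)) :
    Locally (coherentTopology C) (fun U u => ∃ r : U ⟶ R, r ≫ f = u ≫ a ∧ r ≫ g = u ≫ b) := by
  rcases h with h | ⟨s, s', hs, hs', hl⟩
  · have hT := isInitialOfInlEqInr h
    exact .of_forall fun U u => ⟨u ≫ hT.to R, by rw [Category.assoc, hT.hom_ext (hT.to R ≫ f) a],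
      by rw [Category.assoc, hT.hom_ext (hT.to R ≫ g) b]⟩
  · refine (exists_inl_of_comp_map_eq hs).bind ?_
    rintro U u ⟨r, hr, e⟩
    refine ((exists_inr_of_comp_map_eq hs').restrict u).mono ?_
    rintro V v ⟨r', hr', e'⟩
    obtain ⟨t, ht, ht'⟩ := hl.restrict (v ≫ u)
    refine ⟨t, ?_, ?_⟩
    · rw [ht, Category.assoc v u, ← e, Category.assoc, Category.assoc, hr]
    · rw [ht', ← hr', e']

theorem exists_isLocalPushout (hC : IsBarrExact C) (hR : IsMalcevSpan f g) :
    ∃ (Q : C) (h : A ⟶ Q) (k : B ⟶ Q), IsLocalPushout (coherentTopology C) f g h k := by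
  obtain ⟨Q, q, hq, hQ⟩ := exists_quotient_glueRel hC hR
  refine ⟨Q, coprod.inl ≫ q, coprod.inr ≫ q, ?_, fun T t => ?_, fun T a a' h => ?_,
    fun T b b' h => ?_, fun T a b h => ?_⟩
  · rw [← Category.assoc, ← Category.assoc, hQ]
    refine .of_forall fun U u => Or.inr ⟨u ≫ coprod.inl, u ≫ coprod.inr, by simp, by simp, ?_⟩
    refine Linked.of_fst ?_
    simp only [Category.assoc, coprod.inl_desc_assoc, coprod.inr_desc_assoc]
  · refine (locally_exists_lift_of_isRegularEpi q t).bind ?_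
    rintro U u ⟨x, hx⟩
    refine (locally_inl_or_inr x).mono ?_
    rintro V v (⟨a, ha⟩ | ⟨b, hb⟩)
    · exact Or.inl ⟨a, by rw [reassoc_of% ha, hx, Category.assoc]⟩
    · exact Or.inr ⟨b, by rw [reassoc_of% hb, hx, Category.assoc]⟩
  · rw [← Category.assoc, ← Category.assoc, hQ] at h
    refine h.bind fun U u hu => ?_
    rw [← Category.assoc, ← Category.assoc] at hu
    simpa using hu.locally_of_inl_inl
  · rw [← Category.assoc, ← Category.assoc, hQ] at h
    refine h.bind fun U u hu => ?_
    rw [← Category.assoc, ← Category.assoc] at hu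
    simpa using hu.locally_of_inr_inr
  · rw [← Category.assoc, ← Category.assoc, hQ] at h
    refine h.bind fun U u hu => ?_
    rw [← Category.assoc, ← Category.assoc] at hu
    simpa using hu.locally_of_inl_inr

end Pretopos

theorem IsPretopos.isDiexact [HasFiniteLimits C] (hC : IsPretopos C) : IsDiexact C := by
  have := hC.extensive
  have := hC.barrExact.regular
  have key : ∀ {R A B D : C} (f : R ⟶ A) (g : R ⟶ B) (h : A ⟶ D) (k : B ⟶ D),
      IsMalcevSpan f g → IsPushout f g h k →
        IsLocalPushout (coherentTopology C) f g h k := by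
    intro R A B D f g h k hR hp
    obtain ⟨Q, h', k', H⟩ := exists_isLocalPushout hC.barrExact hR
    simpa using H.of_iso (H.isPushout.isoIsPushout _ _ hp)
  refine ⟨fun {R A B} f g hR => ?_, fun {R A B D} f g h k hR hp =>
    (key f g h k hR hp).isStablePushout, fun {R A B D} f g h k hR hp =>
      (key f g h k hR hp).isPullback hR.jointlyMono⟩
  obtain ⟨Q, h', k', H⟩ := exists_isLocalPushout hC.barrExact hR
  exact H.isPushout.hasPushout

/-! ### A diexact category with a strict initial object is extensive -/

section Extensive

variable [HasInitial C]

theorem isPushout_initial_iff {X Y P : C} {a : X ⟶ P} {b : Y ⟶ P} :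
    IsPushout (initial.to X) (initial.to Y) a b ↔ Nonempty (IsColimit (BinaryCofan.mk a b)) := by
  refine ⟨fun h => ⟨BinaryCofan.isColimitMk (fun s => h.desc s.inl s.inr
      (initialIsInitial.hom_ext _ _)) (fun s => h.inl_desc _ _ _) (fun s => h.inr_desc _ _ _)
      fun s m hm hm' => h.hom_ext (hm.trans (h.inl_desc _ _ _).symm)
        (hm'.trans (h.inr_desc _ _ _).symm)⟩,
    fun ⟨h⟩ => IsPushout.of_is_coproduct' h initialIsInitial⟩

variable [HasStrictInitialObjects C]

theorem isPullback_initial_to {X Y : C} (α : X ⟶ Y) :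
    IsPullback (initial.to X) (𝟙 (⊥_ C)) α (initial.to Y) :=
  ⟨⟨initialIsInitial.hom_ext _ _⟩, ⟨PullbackCone.IsLimit.mk _ (fun s => s.snd)
    (fun s => (initialIsInitial.ofIso (asIso s.snd).symm).hom_ext _ _)
    (fun _ => initial.strict_hom_ext _ _) fun _ _ _ _ => initial.strict_hom_ext _ _⟩⟩

variable [HasFiniteLimits C]

theorem isMalcevSpan_initial (A B : C) : IsMalcevSpan (initial.to A) (initial.to B) where
  jointlyMono := ⟨fun _ _ _ _ _ => initial.strict_hom_ext _ _⟩
  exists_factor := by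
    let m : pullback (pullback.snd (initial.to B) (initial.to B) ≫ initial.to A)
      (initial.to A) ⟶ ⊥_ C := pullback.snd _ _
    have hP := initialIsInitial.ofIso (asIso m).symm
    exact ⟨m, hP.hom_ext _ _, hP.hom_ext _ _⟩

variable {X Y P : C} {a : X ⟶ P} {b : Y ⟶ P}

/-- Coproducts, presented as pushouts under the initial object, are universal. -/
theorem IsDiexact.isPushout_initial_of_isPullback (hC : IsDiexact C)
    (h : IsPushout (initial.to X) (initial.to Y) a b) {X' Y' P' : C} {a' : X' ⟶ P'}
    {b' : Y' ⟶ P'} {α : X' ⟶ X} {β : Y' ⟶ Y} {δ : P' ⟶ P} (ha : IsPullback a' α δ a)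
    (hb : IsPullback b' β δ b) : IsPushout (initial.to X') (initial.to Y') a' b' :=
  (hC.isStablePushout _ _ _ _ (isMalcevSpan_initial X Y) h).2 _ _ _ _ _ _ _ _ ha hb
    (isPullback_initial_to α) (isPullback_initial_to β) ⟨initialIsInitial.hom_ext _ _⟩

theorem IsDiexact.mono_of_isPushout_initial (hC : IsDiexact C)
    (h : IsPushout (initial.to X) (initial.to Y) a b) : Mono a := by
  -- Pulling the coproduct back along `a` yields `X` as the coproduct of `X ×[P] X` and `⊥_ C`.
  have h' := hC.isPushout_initial_of_isPullback h (IsPullback.of_hasPullback a a)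
    (hC.isPullback _ _ _ _ (isMalcevSpan_initial X Y) h)
  have : IsIso (pullback.fst a a) := h'.isIso_inl_of_isIso
  exact (IsKernelPair.of_hasPullback a).mono_of_isIso_fst

/-- The converse half of the van Kampen property: a morphism of coproducts compatible with the
inclusions makes the inclusion squares pullbacks. -/
theorem IsDiexact.isPullback_of_isPushout_initial (hC : IsDiexact C)
    (h : IsPushout (initial.to X) (initial.to Y) a b) {X' Y' P' : C} {a' : X' ⟶ P'}
    {b' : Y' ⟶ P'} (h' : IsPushout (initial.to X') (initial.to Y') a' b') {α : X' ⟶ X}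
    {β : Y' ⟶ Y} {δ : P' ⟶ P} (ha : α ≫ a = a' ≫ δ) (hb : β ≫ b = b' ≫ δ) :
    IsPullback a' α δ a := by
  have := hC.mono_of_isPushout_initial h
  -- `P' ×[P] X` is the coproduct of its intersections with `X'` and `Y'`. The first is `X'`, and
  -- the second lies over `X ×[P] Y`, which is initial.
  let c : X' ⟶ pullback δ a := pullback.lift a' α ha.symm
  have hc : c ≫ pullback.fst δ a = a' := pullback.lift_fst _ _ _
  have h₁ : IsPullback c (𝟙 X') (pullback.fst δ a) a' :=
    ⟨⟨by rw [hc, Category.id_comp]⟩, ⟨PullbackCone.IsLimit.mk _ (fun s => s.snd)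
      (fun s => by rw [← cancel_mono (pullback.fst δ a), Category.assoc, hc, s.condition])
      (fun s => Category.comp_id _) fun s m _ hm => by rw [← hm, Category.comp_id]⟩⟩
  have hd := hC.isPullback _ _ _ _ (isMalcevSpan_initial X Y) h
  have h₂ : IsPullback (initial.to (pullback δ a)) (initial.to Y') (pullback.fst δ a) b' := by
    have hl : ∀ s : PullbackCone (pullback.fst δ a) b',
        (s.fst ≫ pullback.snd δ a) ≫ a = (s.snd ≫ β) ≫ b := fun s => by
      rw [Category.assoc, Category.assoc, hb, ← pullback.condition, reassoc_of% s.condition]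
    have hs : ∀ s : PullbackCone (pullback.fst δ a) b', IsInitial s.pt := fun s =>
      initialIsInitial.ofIso (asIso (hd.lift _ _ (hl s))).symm
    exact ⟨⟨initialIsInitial.hom_ext _ _⟩, ⟨PullbackCone.IsLimit.mk _
      (fun s => hd.lift _ _ (hl s)) (fun s => (hs s).hom_ext _ _)
      (fun s => (hs s).hom_ext _ _) fun _ _ _ _ => initial.strict_hom_ext _ _⟩⟩
  have : IsIso c := (hC.isPushout_initial_of_isPullback h' h₁ h₂).isIso_inl_of_isIso
  exact IsPullback.of_iso_pullback ⟨ha.symm⟩ (asIso c) hc (pullback.lift_snd _ _ _)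

theorem IsDiexact.finitaryExtensive (hC : IsDiexact C) : FinitaryExtensive C := by
  have hcop : HasBinaryCoproducts C := by
    have : ∀ X Y : C, HasColimit (pair X Y) := fun X Y => by
      have := hC.hasPushout _ _ (isMalcevSpan_initial X Y)
      exact ⟨⟨_, (isPushout_initial_iff.1
        (IsPushout.of_hasPushout (initial.to X) (initial.to Y))).some⟩⟩
    exact hasBinaryCoproducts_of_hasColimit_pair C
  have := hasFiniteCoproducts_of_has_binary_and_initial (C := C)
  have key : ∀ {X Y : C} (c : BinaryCofan X Y), Nonempty (IsColimit c) ↔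
      IsPushout (initial.to X) (initial.to Y) c.inl c.inr := fun c =>
    Iff.trans ⟨fun ⟨h⟩ => ⟨h.ofIsoColimit (isoBinaryCofanMk c)⟩,
      fun ⟨h⟩ => ⟨h.ofIsoColimit (isoBinaryCofanMk c).symm⟩⟩ isPushout_initial_iff.symm
  refine { van_kampen' := fun {X Y} c hc => ?_ }
  rw [BinaryCofan.isVanKampen_iff]
  intro X' Y' c' α β δ hα hβ
  have h := (key c).1 ⟨hc⟩
  rw [key]
  exact ⟨fun h' => ⟨hC.isPullback_of_isPushout_initial h h' hα hβ,
      hC.isPullback_of_isPushout_initial h.flip h'.flip hβ hα⟩,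
    fun h' => hC.isPushout_initial_of_isPullback h h'.1 h'.2⟩

end Extensive

/-! ### A diexact category is Barr-exact -/

section Exact

theorem isMalcevSpan_of_equivalenceRelation [HasPullbacks C] {R A : C} {s t : R ⟶ A}
    (e : EquivalenceRelation s t) : IsMalcevSpan s t := by
  have htrans : ∀ ⦃T : C⦄ (x y : T ⟶ R), x ≫ t = y ≫ s →
      ∃ z : T ⟶ R, z ≫ s = x ≫ s ∧ z ≫ t = y ≫ t := fun T x y h => by
    obtain ⟨l, hl, hl'⟩ := PullbackCone.IsLimit.lift' e.isLimit x y h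
    exact ⟨l ≫ e.t, by rw [Category.assoc, e.transitivity₁, reassoc_of% hl],
      by rw [Category.assoc, e.transitivity₂, reassoc_of% hl']⟩
  refine ⟨⟨e.right_cancellation⟩, ?_⟩
  let r₁ := pullback.fst (pullback.snd t t ≫ s) s ≫ pullback.fst t t
  let r₂ := pullback.fst (pullback.snd t t ≫ s) s ≫ pullback.snd t t
  let r₃ := pullback.snd (pullback.snd t t ≫ s) s
  obtain ⟨x, hx, hx'⟩ := htrans r₁ (r₂ ≫ e.s) (by
    simp only [r₁, r₂, Category.assoc, e.symmetry₁, pullback.condition])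
  obtain ⟨y, hy, hy'⟩ := htrans x r₃ (by
    rw [hx', Category.assoc, e.symmetry₂, Category.assoc, pullback.condition])
  exact ⟨y, by rw [hy, hx, Category.assoc], hy'⟩

/-- A cocone on a reflexive relation has equal legs, so coequalizers are pushouts. -/
theorem isPushout_iff_of_equivalenceRelation {R A Q : C} {s t : R ⟶ A}
    (e : EquivalenceRelation s t) {q : A ⟶ Q} (w : s ≫ q = t ≫ q) :
    IsPushout s t q q ↔ Nonempty (IsColimit (Cofork.ofπ q w)) := by
  refine ⟨fun h => ⟨h.isLimitFork⟩, fun ⟨h⟩ => ?_⟩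
  have heq : ∀ c : PushoutCocone s t, c.inl = c.inr := fun c => by
    have := e.r ≫= c.condition
    rwa [← Category.assoc, ← Category.assoc, e.reflexivity₁, e.reflexivity₂, Category.id_comp,
      Category.id_comp] at this
  exact ⟨⟨w⟩, ⟨PushoutCocone.IsColimit.mk w
    (fun c => Cofork.IsColimit.desc h c.inl (by rw [c.condition, heq c]))
    (fun c => Cofork.IsColimit.π_desc' h _ _)
    (fun c => (Cofork.IsColimit.π_desc' h _ _).trans (heq c))
    fun c m hm _ => Cofork.IsColimit.hom_ext h (hm.trans (Cofork.IsColimit.π_desc' h _ _).symm)⟩⟩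

variable [HasFiniteLimits C]

theorem IsDiexact.exists_quotient (hC : IsDiexact C) {R A : C} {s t : R ⟶ A}
    (e : EquivalenceRelation s t) : ∃ (Q : C) (q : A ⟶ Q), IsPushout s t q q := by
  have := hC.hasPushout s t (isMalcevSpan_of_equivalenceRelation e)
  have h := IsPushout.of_hasPushout s t
  have heq : pushout.inl s t = pushout.inr s t := by
    have := e.r ≫= h.w
    rwa [← Category.assoc, ← Category.assoc, e.reflexivity₁, e.reflexivity₂, Category.id_comp,
      Category.id_comp] at this
  rw [← heq] at h
  exact ⟨_, _, h⟩

theorem IsDiexact.isRegularEpi_of_isPullback (hC : IsDiexact C) {A Q A' Q' : C} {q : A ⟶ Q}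
    [IsRegularEpi q] {q' : A' ⟶ Q'} {α : A' ⟶ A} {δ : Q' ⟶ Q} (hA : IsPullback q' α δ q) :
    IsRegularEpi q' := by
  have hk := IsKernelPair.of_hasPullback q
  generalize pullback.fst q q = s at hk
  generalize pullback.snd q q = t at hk
  have e := hk.equivalenceRelation q s t (pullbackIsPullback t s)
  have hp : IsPushout s t q q := (isPushout_iff_of_equivalenceRelation e hk.w).2 ⟨hk.toCoequalizer'⟩
  have hs := IsPullback.of_hasPullback α s
  have hw : (pullback.fst α s ≫ q') ≫ δ = (pullback.snd α s ≫ t) ≫ q := by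
    rw [Category.assoc, hA.w, pullback.condition_assoc, hk.w, Category.assoc]
  have ht : IsPullback (hA.lift _ _ hw) (pullback.snd α s) α t := by
    refine IsPullback.of_right ?_ (hA.lift_snd _ _ hw) hA
    rw [hA.lift_fst, ← hk.w]
    exact hs.paste_horiz hA
  have hp' := (hC.isStablePushout s t q q (isMalcevSpan_of_equivalenceRelation e) hp).2
    _ _ _ _ _ _ _ _ hA hA hs ht ⟨(hA.lift_fst _ _ hw).symm⟩
  exact ⟨⟨Cofork.IsColimit.regularEpi hp'.isLimitFork⟩⟩

theorem IsDiexact.isBarrExact (hC : IsDiexact C) : IsBarrExact C where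
  regular :=
    { hasCoequalizer_of_isKernelPair := fun {X Y Z f s t} hk => by
        obtain ⟨Q, q, hq⟩ := hC.exists_quotient
          (hk.equivalenceRelation f s t (pullbackIsPullback t s))
        exact ⟨⟨_, hq.isLimitFork⟩⟩
      regularEpiIsStableUnderBaseChange :=
        { of_isPullback := fun {A Q A' Q' α δ q q'} hA hq => by
            have : IsRegularEpi _ := hq
            exact hC.isRegularEpi_of_isPullback hA.flip } }
  exists_isKernelPair s t hst := by
    obtain ⟨e⟩ := hst.nonempty_equivalenceRelation
    obtain ⟨Q, q, hq⟩ := hC.exists_quotient e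
    exact ⟨Q, q, hC.isPullback s t q q (isMalcevSpan_of_equivalenceRelation e) hq⟩

end Exact

end Diexactness

theorem theorem1 {C : Type u} [Category.{v} C] [HasFiniteLimits C] :
    Diexactness.IsPretopos C ↔
      Diexactness.IsDiexact C ∧ HasInitial C ∧ HasStrictInitialObjects C := by
  refine ⟨fun h => ?_, fun ⟨h, _, _⟩ => ⟨h.finitaryExtensive, h.isBarrExact⟩⟩
  have := h.extensive
  exact ⟨h.isDiexact, inferInstance, inferInstance⟩
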